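/- Let $(R,\mathfrak{m},k)$ be a commutative artinian local ring, let $E=E_R(k)$ be the injective envelope of the $R$-module $k=R/\mathfrak{m}$ (which is the canonical module of $R$), and put $E^*=\operatorname{Hom}_R(E,R)$. Write $\operatorname{tr}_R(E)=\sum_{f\in E^*}\operatorname{Im}(f)$ for the trace ideal of $E$; the ring $R$ is called nearly Gorenstein if $\mathfrak{m}\subseteq\operatorname{tr}_R(E)$. A noetherian local ring is called Gorenstein if it has finite injective dimension as a module over itself. (a) If $R$ is not Gorenstein, then $\mathfrak{m}^2=0$ if and only if $R$ is nearly Gorenstein and $\mathfrak{m}E^*=0$. (b) Assume that $\mathfrak{m}E^*=0$. If $R\cong S/I$ as rings, where $(S,\mathfrak{n})$ is an artinian Gorenstein local ring and $I$ is an ideal of $S$, then $\mathfrak{n}\,(0:_S I)\subseteq I$, where $(0:_S I)=\{s\in S : sI=0\}$. -/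

import Mathlib

universe u v

/-- `ι : M → E` is an injective envelope of the `R`-module `M`: `E` is an injective module, `ι` is
injective, and `E` is an essential extension of the image of `ι`. -/
structure IsInjectiveEnvelope {R : Type u} [CommRing R] {M E : Type u} [AddCommGroup M] [Module R M]
    [AddCommGroup E] [Module R E] (ι : M →ₗ[R] E) : Prop where
  injective_module : Module.Injective R E
  injective_map : Function.Injective ι
  essential : ∀ N : Submodule R E, N ⊓ LinearMap.range ι = ⊥ → N = ⊥

/-- `E` is (a model of) `E_R(k)`, the injective envelope of the residue field `k` of the local
ring `R`. -/
def IsInjectiveEnvelopeOfResidueField (R : Type u) [CommRing R] [IsLocalRing R] (E : Type u)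
    [AddCommGroup E] [Module R E] : Prop :=
  ∃ ι : IsLocalRing.ResidueField R →ₗ[R] E, IsInjectiveEnvelope ι

/-- A noetherian local ring is Gorenstein if it has finite injective dimension as a module over
itself. -/
def IsGorensteinLocalRing (R : Type u) [CommRing R] [IsLocalRing R] [IsNoetherianRing R] : Prop :=
  ∃ n : ℕ, CategoryTheory.HasInjectiveDimensionLE (ModuleCat.of R R) n

/-- The trace ideal of an `R`-module `M`: the sum of the images of all `R`-linear maps `M → R`. -/
def moduleTrace (R : Type u) [CommRing R] (M : Type u) [AddCommGroup M] [Module R M] : Ideal R :=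
  ⨆ f : Module.Dual R M, LinearMap.range f

/-- The local ring `R` is nearly Gorenstein, with respect to its canonical module `ω`: the maximal
ideal of `R` is contained in the trace of `ω`. For an artinian local ring the canonical module is
the injective envelope of the residue field. -/
def IsNearlyGorenstein (R : Type u) [CommRing R] [IsLocalRing R] (ω : Type u)
    [AddCommGroup ω] [Module R ω] : Prop :=
  IsLocalRing.maximalIdeal R ≤ moduleTrace R ω

/-! Write `m` for the maximal ideal of `R`. A linear form on `E` with a unit value would make `R`
self-injective, so otherwise all values lie in `m`; with `m ^ 2 = ⊥` this kills `m E*`. Conversely,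
`m E* = 0` says that `m` kills the trace. For (b), let `φ : S → R` be the quotient map and `x ∈ (0 :
I)`. Some `e ∈ E` has the same annihilator in `S` as `x`, so `t e ↦ t x` extends to an `S`-map `E →
S`. Composed with `φ`, it makes `φ x` a value of a form in `E*`, hence `m` kills `φ x`. Both parts
use that artinian Gorenstein means self-injective. -/

open CategoryTheory Abelian IsLocalRing

/-! ### Socles over an artinian local ring -/

section Socle

variable {R : Type*} [CommRing R] [IsLocalRing R] {M : Type*} [AddCommGroup M] [Module R M]

/-- The linear map from the residue field that sends `1` to an element killed by the maximal
ideal. -/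
def residueToModule (x : M) (hx : ∀ a ∈ maximalIdeal R, a • x = 0) :
    (R ⧸ maximalIdeal R) →ₗ[R] M :=
  (maximalIdeal R).liftQ (LinearMap.toSpanSingleton R M x) fun a ha => by simpa using hx a ha

lemma residueToModule_mk (x : M) (hx : ∀ a ∈ maximalIdeal R, a • x = 0) (r : R) :
    residueToModule x hx (Submodule.Quotient.mk r) = r • x := by
  simp [residueToModule, -Ideal.Quotient.mk_eq_mk]

lemma residueToModule_injective {x : M} (hx : ∀ a ∈ maximalIdeal R, a • x = 0) (h0 : x ≠ 0) :
    Function.Injective (residueToModule x hx) := by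
  rw [injective_iff_map_eq_zero]
  intro q hq
  obtain ⟨r, rfl⟩ := Submodule.Quotient.mk_surjective _ q
  rw [residueToModule_mk] at hq
  rw [Submodule.Quotient.mk_eq_zero]
  by_contra hr
  have hu : IsUnit r := by simpa using hr
  exact h0 (hu.smul_eq_zero.mp hq)

lemma exists_smul_ne_zero_of_pow_smul_eq_zero (n : ℕ) (x : M) (hx : x ≠ 0)
    (h : ∀ a ∈ maximalIdeal R ^ n, a • x = 0) :
    ∃ s : R, s • x ≠ 0 ∧ ∀ a ∈ maximalIdeal R, a • s • x = 0 := by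
  induction n generalizing x with
  | zero => exact absurd (by simpa using h 1 (by simp)) hx
  | succ n ih =>
    by_cases hm : ∀ a ∈ maximalIdeal R, a • x = 0
    · exact ⟨1, by simpa using hx, by simpa using hm⟩
    · push Not at hm
      obtain ⟨a, ha, hax⟩ := hm
      obtain ⟨s, hs, hs'⟩ := ih (a • x) hax fun b hb => by
        rw [smul_smul]
        exact h _ (by rw [pow_succ]; exact Ideal.mul_mem_mul hb ha)
      exact ⟨s * a, by rwa [mul_smul], fun b hb => by rw [mul_smul]; exact hs' b hb⟩

lemma maximalIdeal_pow_eq_bot (R : Type*) [CommRing R] [IsLocalRing R] [IsArtinianRing R] :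
    ∃ n : ℕ, maximalIdeal R ^ n = ⊥ := by
  have h := IsArtinianRing.isNilpotent_jacobson_bot (R := R)
  rwa [IsLocalRing.jacobson_eq_maximalIdeal _ bot_ne_top] at h

lemma exists_smul_mem_socle [IsArtinianRing R] (x : M) (hx : x ≠ 0) :
    ∃ s : R, s • x ≠ 0 ∧ ∀ a ∈ maximalIdeal R, a • s • x = 0 := by
  obtain ⟨n, hn⟩ := maximalIdeal_pow_eq_bot R
  refine exists_smul_ne_zero_of_pow_smul_eq_zero n x hx fun a ha => ?_
  rw [hn, Ideal.mem_bot] at ha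
  simp [ha]

/-- The socle of a self-injective local ring is a vector space of dimension at most one. -/
lemma exists_isUnit_mul_eq_of_mem_socle [Module.Injective R R] {x y : R}
    (hx : ∀ a ∈ maximalIdeal R, a • x = 0) (hy : ∀ a ∈ maximalIdeal R, a • y = 0)
    (hx0 : x ≠ 0) (hy0 : y ≠ 0) : ∃ u : R, IsUnit u ∧ u * x = y := by
  obtain ⟨h, hh⟩ := Module.Injective.extension_property R R _ _ (residueToModule x hx)
    (residueToModule_injective hx hx0) (residueToModule y hy)
  have hxy : h x = y := by
    have := LinearMap.congr_fun hh (Submodule.Quotient.mk 1)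
    simpa only [LinearMap.comp_apply, residueToModule_mk, one_smul] using this
  have hmul : h 1 * x = y := by
    rw [← hxy, mul_comm, ← smul_eq_mul, ← map_smul, smul_eq_mul, mul_one]
  refine ⟨h 1, ?_, hmul⟩
  by_contra hu
  exact hy0 (by rw [← hmul]; exact hx _ ((mem_maximalIdeal _).mpr hu))

end Socle

/-! ### Finite injective dimension forces injectivity -/

section InjectiveDimension

/-- A vector space over the residue field of an artinian local ring embeds into a free module. -/
lemma exists_injective_finsupp_of_maximalIdeal_smul_eq_zero {S : Type u} [CommRing S]
    [IsLocalRing S] [IsArtinianRing S] (V : Type u) [AddCommGroup V] [Module S V]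
    (hV : ∀ a ∈ maximalIdeal S, ∀ v : V, a • v = 0) :
    ∃ (ι : Type u) (f : V →ₗ[S] (ι →₀ S)), Function.Injective f := by
  obtain ⟨s, hs, hs'⟩ := exists_smul_mem_socle (R := S) (1 : S) one_ne_zero
  have hV' : Module.IsTorsionBySet S V (maximalIdeal S) := fun v a => hV a a.2 v
  let := hV'.module
  let : Field (S ⧸ maximalIdeal S) := Ideal.Quotient.field _
  let b := Module.Basis.ofVectorSpace (S ⧸ maximalIdeal S) V
  let e : V →ₗ[S] (_ →₀ (S ⧸ maximalIdeal S)) := b.repr.toLinearMap.restrictScalars S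
  refine ⟨_, (Finsupp.mapRange.linearMap (residueToModule (s • (1 : S)) hs')) ∘ₗ e, ?_⟩
  rw [LinearMap.coe_comp]
  refine Function.Injective.comp ?_ b.repr.injective
  exact Finsupp.mapRange_injective _ (map_zero _) (residueToModule_injective hs' hs)

variable {S : Type u} [CommRing S] [IsLocalRing S] [IsArtinianRing S]

/-- Dimension shifting against the usual direction: residue vector spaces embed in free modules, and
every module is an iterated extension of such spaces. -/
lemma hasInjectiveDimensionLT_succ_of_succ_succ (M : ModuleCat.{u} S) (n : ℕ)
    [HasInjectiveDimensionLT M (n + 2)] : HasInjectiveDimensionLT M (n + 1) := by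
  have killed (V : ModuleCat.{u} S) (hV : ∀ a ∈ maximalIdeal S, ∀ v : V, a • v = 0)
      (e : Ext V M (n + 1)) : e = 0 := by
    obtain ⟨ι, f, hf⟩ := exists_injective_finsupp_of_maximalIdeal_smul_eq_zero V hV
    let T : ShortComplex (ModuleCat.{u} S) :=
      ModuleCat.shortComplexOfCompEqZero _ _ f.exact_map_mkQ_range.linearMap_comp_eq_zero
    have hT : T.ShortExact := ModuleCat.shortComplex_shortExact T
      f.exact_map_mkQ_range hf (Submodule.mkQ_surjective _)
    have : Projective T.X₂ :=
      (IsProjective.iff_projective (R := S) (ι →₀ S)).mp inferInstance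
    -- The obstruction to lifting `e` to the free module lies in `Ext` of degree `n + 2`, which
    -- vanishes.
    obtain ⟨e', he'⟩ := Ext.contravariant_sequence_exact₁ hT M (n₁ := n + 2) e (by lia)
      (Ext.eq_zero_of_hasInjectiveDimensionLT _ (n + 2) le_rfl)
    rw [← he', e'.eq_zero_of_projective, Ext.comp_zero]
  have nilp (j : ℕ) : ∀ (Y : ModuleCat.{u} S)
      (_ : ∀ a ∈ maximalIdeal S ^ j, ∀ y : Y, a • y = 0) (e : Ext Y M (n + 1)), e = 0 := by
    induction j with
    | zero =>
      intro Y hY e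
      refine killed Y (fun a _ y => ?_) e
      have : y = 0 := by simpa using hY 1 (by simp) y
      simp [this]
    | succ j ih =>
      intro Y hY e
      let N : Submodule S Y := maximalIdeal S • ⊤
      let T : ShortComplex (ModuleCat.{u} S) :=
        ModuleCat.shortComplexOfCompEqZero N.subtype N.mkQ
          (LinearMap.exact_subtype_mkQ N).linearMap_comp_eq_zero
      have hT : T.ShortExact := ModuleCat.shortComplex_shortExact T
        (LinearMap.exact_subtype_mkQ N) N.injective_subtype N.mkQ_surjective
      have h₁ : (Ext.mk₀ T.f).comp e (zero_add (n + 1)) = 0 := by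
        refine ih _ (fun a ha y => ?_) _
        obtain ⟨y, hy⟩ := y
        apply Subtype.ext
        change a • y = 0
        refine Submodule.smul_induction_on hy (fun b hb z _ => ?_) (fun z w hz hw => ?_)
        · rw [smul_smul]
          exact hY _ (by rw [pow_succ]; exact Ideal.mul_mem_mul ha hb) z
        · rw [smul_add, hz, hw, add_zero]
      obtain ⟨e', he'⟩ := Ext.contravariant_sequence_exact₂ hT M e h₁
      rw [← he', killed _ (fun a ha y => ?_) e', Ext.comp_zero]
      obtain ⟨y, rfl⟩ := N.mkQ_surjective y
      rw [← map_smul]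
      exact (Submodule.Quotient.mk_eq_zero N).mpr (Submodule.smul_mem_smul ha trivial)
  obtain ⟨j, hj⟩ := maximalIdeal_pow_eq_bot S
  refine hasInjectiveDimensionLT_of_enoughProjectives M (n + 1) fun Y => ⟨fun e e' => ?_⟩
  have hY : ∀ a ∈ maximalIdeal S ^ j, ∀ y : Y, a • y = 0 := fun a ha y => by
    rw [hj, Ideal.mem_bot] at ha
    simp [ha]
  rw [nilp j Y hY e, nilp j Y hY e']

/-- Over an artinian local ring, modules of finite injective dimension are injective. -/
lemma injective_of_hasInjectiveDimensionLE (M : ModuleCat.{u} S) (n : ℕ)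
    (h : HasInjectiveDimensionLE M n) : Module.Injective S M := by
  induction n with
  | zero =>
    rw [Module.injective_iff_injective_object]
    exact injective_iff_hasInjectiveDimensionLT_one.mpr h
  | succ n ih => exact ih (hasInjectiveDimensionLT_succ_of_succ_succ M n)

lemma isGorensteinLocalRing_iff_injective : IsGorensteinLocalRing S ↔ Module.Injective S S := by
  refine ⟨fun ⟨n, h⟩ => injective_of_hasInjectiveDimensionLE _ n h, fun h => ⟨0, ?_⟩⟩
  exact injective_iff_hasInjectiveDimensionLT_one.mp
    ((Module.injective_iff_injective_object S S).mp h)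

end InjectiveDimension

/-! ### The trace of `E` and part (a) -/

section ResidueEnvelope

variable {R : Type u} [CommRing R] [IsLocalRing R] {E : Type u} [AddCommGroup E] [Module R E]

lemma IsInjectiveEnvelopeOfResidueField.exists_ne_zero
    (hE : IsInjectiveEnvelopeOfResidueField R E) :
    ∃ e : E, e ≠ 0 ∧ ∀ a ∈ maximalIdeal R, a • e = 0 := by
  obtain ⟨ι, hι⟩ := hE
  refine ⟨ι 1, fun h => one_ne_zero (hι.injective_map (h.trans (map_zero ι).symm)),
    fun a ha => ?_⟩
  rw [← map_smul, Algebra.smul_def, mul_one]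
  change ι (residue R a) = 0
  rw [(residue_eq_zero_iff a).mpr ha, map_zero]

lemma maximalIdeal_smul_dual_eq_bot_iff :
    maximalIdeal R • (⊤ : Submodule R (Module.Dual R E)) = ⊥ ↔
      ∀ a ∈ maximalIdeal R, ∀ (f : Module.Dual R E) (x : E), a * f x = 0 := by
  rw [eq_bot_iff, Submodule.smul_le]
  refine forall₂_congr fun a _ => ⟨fun h f x => ?_, fun h f _ => ?_⟩
  · exact LinearMap.congr_fun ((Submodule.mem_bot R).mp (h f trivial)) x
  · exact (Submodule.mem_bot R).mpr (LinearMap.ext (h f))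

/-- If a linear form on an injective module is surjective, then the ring is self-injective. -/
lemma injective_self_of_dual_apply_eq_one {R : Type u} [CommRing R] {E : Type u}
    [AddCommGroup E] [Module R E] (hE : Module.Injective R E) (f : Module.Dual R E)
    (x : E) (hx : f x = 1) : Module.Injective R R where
  out X Y _ _ _ _ i hi g := by
    obtain ⟨h, hh⟩ := hE.out i hi (LinearMap.toSpanSingleton R E x ∘ₗ g)
    refine ⟨f ∘ₗ h, fun y => ?_⟩
    simp [hh, hx]

lemma maximalIdeal_sq_eq_bot_of_isNearlyGorenstein (h : IsNearlyGorenstein R E)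
    (h' : maximalIdeal R • (⊤ : Submodule R (Module.Dual R E)) = ⊥) :
    maximalIdeal R ^ 2 = ⊥ := by
  rw [maximalIdeal_smul_dual_eq_bot_iff] at h'
  have htr : moduleTrace R E ≤ (⊥ : Ideal R).colon (maximalIdeal R : Set R) := by
    refine iSup_le fun f => ?_
    rintro _ ⟨x, rfl⟩
    rw [Submodule.mem_colon]
    intro a ha
    rw [smul_eq_mul, mul_comm, h' a ha f x]
    exact zero_mem _
  rw [pow_two, eq_bot_iff, Ideal.mul_le]
  exact fun a ha b hb => Submodule.mem_colon.mp (htr (h ha)) b hb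

lemma maximalIdeal_smul_dual_eq_bot_of_sq_eq_bot (hE : Module.Injective R E)
    (hR : ¬ Module.Injective R R) (h : maximalIdeal R ^ 2 = ⊥) :
    maximalIdeal R • (⊤ : Submodule R (Module.Dual R E)) = ⊥ := by
  rw [maximalIdeal_smul_dual_eq_bot_iff]
  intro a ha f x
  have hfx : f x ∈ maximalIdeal R := by
    by_contra hu
    obtain ⟨u, hu⟩ : IsUnit (f x) := by simpa using hu
    refine hR (injective_self_of_dual_apply_eq_one hE f ((↑u⁻¹ : R) • x) ?_)
    rw [map_smul, ← hu, smul_eq_mul, Units.inv_mul]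
  have := Ideal.mul_mem_mul ha hfx
  rwa [← pow_two, h, Ideal.mem_bot] at this

/-- Since `E / mE` is a nonzero vector space, it maps onto `k`; as `m x = 0`, sending `1` to `x`
then gives a form on `E` with image `R x`. -/
lemma isNearlyGorenstein_of_sq_eq_bot (hE : IsInjectiveEnvelopeOfResidueField R E)
    (h : maximalIdeal R ^ 2 = ⊥) : IsNearlyGorenstein R E := by
  intro x hx
  have hxk : ∀ a ∈ maximalIdeal R, a • x = 0 := fun a ha => by
    have := Ideal.mul_mem_mul ha hx
    rwa [← pow_two, h, Ideal.mem_bot] at this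
  obtain ⟨e, he, -⟩ := hE.exists_ne_zero
  let N : Submodule R E := maximalIdeal R • ⊤
  have hN : N ≠ ⊤ := by
    intro hN
    have h2 : (maximalIdeal R ^ 2) • (⊤ : Submodule R E) = ⊤ := by
      rw [pow_two, Submodule.mul_smul]
      change maximalIdeal R • N = ⊤
      rw [hN]
      exact hN
    rw [h, Submodule.bot_smul] at h2
    exact he ((Submodule.mem_bot R).mp (h2 ▸ Submodule.mem_top))
  obtain ⟨y, hy⟩ : ∃ y, y ∉ N := by
    by_contra! hc
    exact hN (Submodule.eq_top_iff'.mpr hc)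
  have hV : Module.IsTorsionBySet R (E ⧸ N) (maximalIdeal R) := by
    rintro v ⟨a, ha⟩
    obtain ⟨z, rfl⟩ := N.mkQ_surjective v
    change a • N.mkQ z = 0
    rw [← map_smul]
    exact (Submodule.Quotient.mk_eq_zero N).mpr (Submodule.smul_mem_smul ha trivial)
  let := hV.module
  let : Field (R ⧸ maximalIdeal R) := Ideal.Quotient.field _
  have hy0 : N.mkQ y ≠ 0 := fun h0 => hy ((Submodule.Quotient.mk_eq_zero N).mp h0)
  obtain ⟨g, hg⟩ := Module.Projective.exists_dual_ne_zero (R ⧸ maximalIdeal R) hy0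
  let f : Module.Dual R E := residueToModule x hxk ∘ₗ g.restrictScalars R ∘ₗ N.mkQ
  have hf (c : R) (hc : Submodule.Quotient.mk c = g (N.mkQ y)) : f y = c * x := by
    change residueToModule x hxk (g (N.mkQ y)) = c * x
    rw [← hc, residueToModule_mk, smul_eq_mul]
  obtain ⟨c, hc⟩ := Submodule.Quotient.mk_surjective _ (g (N.mkQ y))
  have hcu : IsUnit c := by
    by_contra hcu
    refine hg ?_
    rw [← hc]
    exact (Submodule.Quotient.mk_eq_zero _).mpr ((mem_maximalIdeal c).mpr hcu)
  have hmem : c * x ∈ moduleTrace R E := by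
    rw [← hf c hc]
    exact (le_iSup (fun f : Module.Dual R E => LinearMap.range f) f) ⟨y, rfl⟩
  exact (Ideal.unit_mul_mem_iff_mem _ hcu).mp hmem

end ResidueEnvelope

/-! ### Self-injective covers and part (b) -/

section Quotient

variable {R : Type u} [CommRing R] [IsLocalRing R] {E : Type u} [AddCommGroup E] [Module R E]
variable {S : Type v} [CommRing S] [IsLocalRing S] [IsArtinianRing S]

/-- If `x` is killed by the kernel of `φ : S → R`, where `S` is self-injective, then `E_R(k)` has an
element with the same annihilator in `S` as `x`. -/
lemma exists_map_smul_eq_zero_iff [Module.Injective S S]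
    (hE : IsInjectiveEnvelopeOfResidueField R E) (φ : S →+* R) (hφ : Function.Surjective φ)
    (x : S) (hx : ∀ i ∈ RingHom.ker φ, i * x = 0) :
    ∃ e : E, ∀ t : S, φ t • e = 0 ↔ t * x = 0 := by
  rcases eq_or_ne x 0 with rfl | hx0
  · exact ⟨0, by simp⟩
  have hloc : IsLocalHom φ := IsLocalHom.of_surjective φ hφ
  obtain ⟨s, hs, hs'⟩ := exists_smul_mem_socle (R := S) x hx0
  obtain ⟨ε, hε, hε'⟩ := hE.exists_ne_zero
  obtain ⟨ι, hι⟩ := hE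
  have := hι.injective_module
  -- As `ker φ` kills `x`, `R ⧸ J` is a copy of `S x`. The class of `φ s` is a socle element;
  -- sending it to `ε` extends to `R ⧸ J → E`, and `e` is the image of `1`.
  let J : Ideal R := Ideal.map φ (Ideal.span {x} : Ideal S).annihilator
  have hJ (t : S) : φ t ∈ J ↔ t * x = 0 := by
    have ann (r : S) : r ∈ (Ideal.span {x} : Ideal S).annihilator ↔ r * x = 0 := by
      rw [← smul_eq_mul]
      exact Submodule.mem_annihilator_span_singleton x r
    rw [Ideal.mem_map_iff_of_surjective φ hφ]
    constructor
    · rintro ⟨r, hr, hrt⟩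
      have := hx (t - r) (by rw [RingHom.mem_ker, map_sub, hrt, sub_self])
      rw [sub_mul, (ann r).mp hr, sub_zero] at this
      exact this
    · exact fun ht => ⟨t, (ann t).mpr ht, rfl⟩
  have hsJ : ∀ a ∈ maximalIdeal R, a • (Submodule.Quotient.mk (φ s) : R ⧸ J) = 0 := by
    intro a ha
    obtain ⟨b, rfl⟩ := hφ a
    have hb : b ∈ maximalIdeal S := (mem_maximalIdeal b).mpr fun hb =>
      (mem_maximalIdeal _).mp ha (hb.map φ)
    rw [← Submodule.Quotient.mk_smul, Submodule.Quotient.mk_eq_zero, smul_eq_mul, ← map_mul, hJ]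
    simpa [mul_assoc] using hs' b hb
  have hsJ0 : (Submodule.Quotient.mk (φ s) : R ⧸ J) ≠ 0 := by
    rw [Ne, Submodule.Quotient.mk_eq_zero, hJ]
    simpa using hs
  obtain ⟨h, hh⟩ := Module.Injective.extension_property R E _ _ (residueToModule _ hsJ)
    (residueToModule_injective hsJ hsJ0) (residueToModule ε hε')
  have hsmul (t : S) : φ t • h (Submodule.Quotient.mk 1) = h (Submodule.Quotient.mk (φ t)) := by
    rw [← map_smul, ← Submodule.Quotient.mk_smul, smul_eq_mul, mul_one]
  have hsε : φ s • h (Submodule.Quotient.mk 1) = ε := by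
    rw [hsmul]
    have := LinearMap.congr_fun hh (Submodule.Quotient.mk 1)
    simpa only [LinearMap.comp_apply, residueToModule_mk, one_smul] using this
  have of_mul {t : S} (ht : t * x = 0) : φ t • h (Submodule.Quotient.mk 1) = 0 := by
    rw [hsmul, (Submodule.Quotient.mk_eq_zero J).mpr ((hJ t).mpr ht), map_zero]
  refine ⟨h (Submodule.Quotient.mk 1), fun t => ⟨fun ht => ?_, of_mul⟩⟩
  by_contra htx
  obtain ⟨r, hr, hr'⟩ := exists_smul_mem_socle (R := S) (t * x) htx
  -- The socle of `S` is a line, so `u s - r t` kills `x` and hence `e`; with `t e = 0` this gives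
  -- `u ε = 0`.
  obtain ⟨u, hu, hux⟩ := exists_isUnit_mul_eq_of_mem_socle hs' hr' hs hr
  have h1 : (u * s - r * t) * x = 0 := by
    simp only [smul_eq_mul] at hux
    rw [sub_mul, mul_assoc, mul_assoc, hux, sub_self]
  have h2 := of_mul h1
  rw [map_sub, sub_smul, map_mul, map_mul, mul_smul, mul_smul, ht, smul_zero, sub_zero, hsε] at h2
  exact hε ((hu.map φ).smul_eq_zero.mp h2)

/-- Elements of a self-injective ring that are killed by the kernel of `φ : S → R` are mapped
into the trace of `E_R(k)`, as values of single linear forms. -/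
lemma exists_dual_apply_eq_map [Module.Injective S S]
    (hE : IsInjectiveEnvelopeOfResidueField R E) (φ : S →+* R) (hφ : Function.Surjective φ)
    (x : S) (hx : ∀ i ∈ RingHom.ker φ, i * x = 0) :
    ∃ (f : Module.Dual R E) (e : E), f e = φ x := by
  obtain ⟨e, he⟩ := exists_map_smul_eq_zero_iff hE φ hφ x hx
  let : Module S E := Module.compHom E φ
  have smul_def (s : S) (z : E) : s • z = φ s • z := rfl
  let K : Submodule S S := LinearMap.ker (LinearMap.toSpanSingleton S E e)
  have hK : K ≤ LinearMap.ker (LinearMap.toSpanSingleton S S x) := fun t ht => by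
    have : t • e = 0 := by simpa [K] using ht
    simpa using (he t).mp this
  -- `S ⧸ K` stands for the submodule `S e` of `E`.
  obtain ⟨h, hh⟩ := Module.Injective.extension_property S S _ _
    (K.liftQ (LinearMap.toSpanSingleton S E e) le_rfl)
    (LinearMap.ker_eq_bot.mp (Submodule.ker_liftQ_eq_bot _ _ _ le_rfl))
    (K.liftQ (LinearMap.toSpanSingleton S S x) hK)
  have hex : h e = x := by
    have := LinearMap.congr_fun hh (Submodule.Quotient.mk 1)
    simpa only [LinearMap.comp_apply, Submodule.liftQ_apply, LinearMap.toSpanSingleton_apply,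
      one_smul] using this
  refine ⟨{ toFun := fun z => φ (h z), map_add' := by simp, map_smul' := fun r z => ?_ }, e, ?_⟩
  · obtain ⟨s, rfl⟩ := hφ r
    rw [← smul_def, map_smul, smul_eq_mul, map_mul]
    rfl
  · exact congrArg φ hex

lemma maximalIdeal_mul_colon_le (hE : IsInjectiveEnvelopeOfResidueField R E)
    (h : maximalIdeal R • (⊤ : Submodule R (Module.Dual R E)) = ⊥) (I : Ideal S)
    (hS : Module.Injective S S) (e : R ≃+* S ⧸ I) :
    maximalIdeal S * (⊥ : Ideal S).colon (I : Set S) ≤ I := by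
  rw [maximalIdeal_smul_dual_eq_bot_iff] at h
  let φ : S →+* R := e.symm.toRingHom.comp (Ideal.Quotient.mk I)
  have hφ : Function.Surjective φ := e.symm.surjective.comp Ideal.Quotient.mk_surjective
  have hker (s : S) : φ s = 0 ↔ s ∈ I := by
    rw [← Ideal.Quotient.eq_zero_iff_mem]
    exact e.symm.map_eq_zero_iff
  have hloc : IsLocalHom φ := IsLocalHom.of_surjective φ hφ
  rw [Ideal.mul_le]
  intro a ha x hx
  obtain ⟨f, z, hfz⟩ := exists_dual_apply_eq_map hE φ hφ x fun i hi => by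
    have := Submodule.mem_colon.mp hx i ((hker i).mp hi)
    rwa [Ideal.mem_bot, smul_eq_mul, mul_comm] at this
  have ha' : φ a ∈ maximalIdeal R := (mem_maximalIdeal _).mpr fun hu =>
    (mem_maximalIdeal a).mp ha (hloc.map_nonunit a hu)
  rw [← hker, map_mul, ← hfz]
  exact h _ ha' f z

end Quotient

theorem theoremD (R : Type u) [CommRing R] [IsLocalRing R] [IsArtinianRing R]
    (E : Type u) [AddCommGroup E] [Module R E] (hE : IsInjectiveEnvelopeOfResidueField R E) :
    (¬ IsGorensteinLocalRing R →
      (IsLocalRing.maximalIdeal R ^ 2 = ⊥ ↔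
        (IsNearlyGorenstein R E ∧
          IsLocalRing.maximalIdeal R • (⊤ : Submodule R (Module.Dual R E)) = ⊥))) ∧
    (IsLocalRing.maximalIdeal R • (⊤ : Submodule R (Module.Dual R E)) = ⊥ →
      ∀ (S : Type v) [CommRing S] [IsLocalRing S] [IsArtinianRing S] (I : Ideal S),
        IsGorensteinLocalRing S → Nonempty (R ≃+* S ⧸ I) →
          IsLocalRing.maximalIdeal S * (⊥ : Ideal S).colon (I : Set S) ≤ I) := by
  refine ⟨fun hR => ⟨fun h => ⟨isNearlyGorenstein_of_sq_eq_bot hE h, ?_⟩, fun h =>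
    maximalIdeal_sq_eq_bot_of_isNearlyGorenstein h.1 h.2⟩, fun h S _ _ _ I hS ⟨e⟩ =>
    maximalIdeal_mul_colon_le hE h I (isGorensteinLocalRing_iff_injective.mp hS) e⟩
  obtain ⟨ι, hι⟩ := hE
  exact maximalIdeal_smul_dual_eq_bot_of_sq_eq_bot hι.injective_module
    (fun h => hR (isGorensteinLocalRing_iff_injective.mpr h)) h
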